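/- Let $p\colon \mathbb{E}\to\mathbb{B}$ be a Grothendieck fibration. A map $f$ of $\mathbb{E}$ is \emph{vertical} if $p(f)$ is an identity, and $V(\mathbb{E})$ is the full subcategory of the arrow category $\mathbb{E}^{\mathbf 2}$ on the vertical maps, with functors $\operatorname{dom},\operatorname{cod}\colon V(\mathbb{E})\to\mathbb{E}$. A \emph{monad over} a functor $q\colon\mathbb{F}\to\mathbb{E}$ is a monad on $\mathbb{F}$ whose underlying endofunctor $T$ satisfies $q T=q$ and whose unit and multiplication have components sent by $q$ to identities; comonads over $q$ are defined dually. A \emph{functorial factorisation over $p$} factors every vertical map $f\colon X\to Y$, functorially in $f\in V(\mathbb{E})$, as $X\xrightarrow{Lf}Kf\xrightarrow{Rf}Y$ with $Lf$ and $Rf$ vertical. Then $R$ is a pointed endofunctor of $V(\mathbb{E})$ with point $\lambda_f=(Lf,1_Y)\colon f\to Rf$, and $L$ is a copointed endofunctor with copoint $\rho_f=(1_X,Rf)\colon Lf\to f$. An \emph{lawfs over $p$} is a functorial factorisation together with $\Sigma\colon L\Rightarrow L^2$ making $(L,\rho,\Sigma)$ a comonad over $\operatorname{dom}$. An \emph{awfs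 over $p$} is an lawfs together with $\Pi\colon R^2\Rightarrow R$ making $(R,\lambda,\Pi)$ a monad over $\operatorname{cod}$, such that the canonical transformation $LR\Rightarrow RL$, whose component at $f$ is the square from $LRf$ to $RLf$ formed by the codomain component $Kf\to KLf$ of $\Sigma_f$ and the domain component $KRf\to Kf$ of $\Pi_f$, is a distributive law of the comonad $L$ over the monad $R$. A \emph{morphism of lawfs's} $\xi\colon(L,R,\Sigma)\to(L',R',\Sigma')$ is a natural family of maps $\xi_f\colon Kf\to K'f$ with $\xi_f\circ Lf=L'f$ and $R'f\circ\xi_f=Rf$, such that the induced $L\Rightarrow L'$ respects the comultiplications. For a pointed endofunctor $(R,\lambda)$ an \emph{algebra} on $f$ is a map $\alpha\colon Rf\to f$ with $\alpha\circ\lambda_f=1_f$; for a monad one also requires the multiplication law. For an lawfs $(L_1,R_1)$, let $R_1\text{-}\mathrm{Alg}$ be the category of algebras for the pointed endofunctor $(R_1,\lambda_1)$. An awfs $(L,R)$ is \emph{algebraically free} on an lawfs $(L_1,R_1)$ if it is equipped with a morphism of lawfs's $\xi\colon(L_1,R_1)\to(L,R)$ such that the composite functor from algebras for the monad $(R,\lambda,\Pi)$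 to algebras for the pointed endofunctor $(R,\lambda)$ (forgetting the multiplication law) to $R_1\text{-}\mathrm{Alg}$ (precomposing with $\xi$) is an isomorphism of categories. A functor $U\colon\mathbb{T}\to V(\mathbb{E})$ is \emph{monadic over $\operatorname{cod}\colon V(\mathbb{E})\to\mathbb{E}$} if there is a monad $T$ over $\operatorname{cod}$ and an isomorphism of categories $\mathbb{T}\cong T\text{-}\mathrm{Alg}$ commuting with $U$ and the forgetful functor $T\text{-}\mathrm{Alg}\to V(\mathbb{E})$. \textbf{Theorem.} Let $(L_1,R_1)$ be an lawfs over a fibration $p\colon\mathbb{E}\to\mathbb{B}$. Then there is an awfs over $p$ algebraically free on $(L_1,R_1)$ if and only if the forgetful functor $U\colon R_1\text{-}\mathrm{Alg}\to V(\mathbb{E})$ is monadic over $\operatorname{cod}\colon V(\mathbb{E})\to\mathbb{E}$. -/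

import Mathlib

open CategoryTheory

universe v v' u u'

namespace FibAwfs

/-! ### Vertical maps, and (co)monads over a functor -/

/-- A morphism `f` is vertical for `q` if `q` sends its domain and codomain to the same object
and sends `f` itself to the identity of that object. -/
def IsVertical {F : Type u} [Category.{v} F] {E : Type u'} [Category.{v'} E] (q : F ⥤ E)
    {X Y : F} (f : X ⟶ Y) : Prop :=
  q.IsHomLift (𝟙 (q.obj X)) f

/-- A monad over a functor `q : F ⥤ E`: the underlying endofunctor commutes (strictly) with `q`,
and the unit and the multiplication are pointwise vertical. -/
structure IsMonadOver {F : Type u} [Category.{v} F] {E : Type u'} [Category.{v'} E]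
    (M : Monad F) (q : F ⥤ E) : Prop where
  comp_eq : M.toFunctor ⋙ q = q
  unit_vertical : ∀ X : F, IsVertical q (M.η.app X)
  mul_vertical : ∀ X : F, IsVertical q (M.μ.app X)

/-- A functor `U : T ⥤ F` is monadic over `q : F ⥤ E` if it is isomorphic, as a category
over `F`, to the category of algebras of some monad over `q`. -/
def IsMonadicOver {T : Type*} [Category* T] {F : Type u} [Category.{v} F]
    {E : Type u'} [Category.{v'} E] (U : T ⥤ F) (q : F ⥤ E) : Prop :=
  ∃ M : Monad F, IsMonadOver M q ∧
    ∃ Φ : IsoCat T M.Algebra, Φ.functor ⋙ M.forget = U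

/-! ### Algebras for a pointed endofunctor -/

section PointedAlgebras

variable {F : Type u} [Category.{v} F]

/-- Algebras for a pointed endofunctor `(T, η)`: algebras for the endofunctor `T` satisfying the
unit law. They form a full subcategory of the algebras of the endofunctor. -/
abbrev PointedAlgebra (T : F ⥤ F) (η : 𝟭 F ⟶ T) :=
  ObjectProperty.FullSubcategory
    (fun A : Endofunctor.Algebra T => η.app A.a ≫ A.str = 𝟙 A.a)

/-- The functor forgetting the algebra structure. -/
abbrev PointedAlgebra.forget (T : F ⥤ F) (η : 𝟭 F ⟶ T) : PointedAlgebra T η ⥤ F :=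
  ObjectProperty.ι _ ⋙ Endofunctor.Algebra.forget T

/-- The functor from the algebras of `(T', η')` to those of `(T, η)` induced by a morphism of
pointed endofunctors `(T, η) ⟶ (T', η')`, by precomposing structure maps. -/
def PointedAlgebra.restrict {T T' : F ⥤ F} {η : 𝟭 F ⟶ T} {η' : 𝟭 F ⟶ T'} (ξ : T ⟶ T')
    (hξ : η ≫ ξ = η') : PointedAlgebra T' η' ⥤ PointedAlgebra T η where
  obj A := ⟨⟨A.obj.a, ξ.app A.obj.a ≫ A.obj.str⟩, by
    have h : η'.app A.obj.a ≫ A.obj.str = 𝟙 A.obj.a := A.property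
    exact (Category.assoc _ _ _).symm.trans
      ((congrArg (· ≫ A.obj.str) (NatTrans.congr_app hξ A.obj.a)).trans h)⟩
  map φ := ObjectProperty.homMk ⟨φ.hom.f, by
    have h := φ.hom.h
    simp only [ξ.naturality_assoc, h, Category.assoc]⟩
  map_id _ := rfl
  map_comp _ _ := rfl

/-- The functor from the algebras of a monad to the algebras of its underlying pointed
endofunctor. -/
def PointedAlgebra.ofMonad (M : Monad F) : M.Algebra ⥤ PointedAlgebra M.toFunctor M.η where
  obj A := ⟨⟨A.A, A.a⟩, A.unit⟩
  map φ := ObjectProperty.homMk ⟨φ.f, φ.h⟩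
  map_id _ := rfl
  map_comp _ _ := rfl

/-- A distributive law of a comonad `G` over a monad `M`: a natural transformation `GM ⟶ MG`
compatible with unit, counit, multiplication and comultiplication. -/
structure IsDistributiveLaw (G : Comonad F) (M : Monad F)
    (δ : M.toFunctor ⋙ G.toFunctor ⟶ G.toFunctor ⋙ M.toFunctor) : Prop where
  unit : ∀ X, G.map (M.η.app X) ≫ δ.app X = M.η.app (G.obj X)
  counit : ∀ X, δ.app X ≫ M.map (G.ε.app X) = G.ε.app (M.obj X)
  mul : ∀ X, G.map (M.μ.app X) ≫ δ.app X =
    δ.app (M.obj X) ≫ M.map (δ.app X) ≫ M.μ.app (G.obj X)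
  comul : ∀ X, δ.app X ≫ M.map (G.δ.app X) =
    G.δ.app (M.obj X) ≫ G.map (δ.app X) ≫ δ.app (G.obj X)

end PointedAlgebras

/-! ### The category of vertical maps -/

variable {E : Type u} [Category.{v} E] {B : Type u'} [Category.{v'} B]

/-- The category of vertical maps: the full subcategory of the arrow category of `E` on the
vertical maps of `p`. Its morphisms are all commutative squares. -/
abbrev Vert (p : E ⥤ B) :=
  ObjectProperty.FullSubcategory (fun f : Arrow E => IsVertical p f.hom)

/-- The domain functor. -/
abbrev Vert.dom (p : E ⥤ B) : Vert p ⥤ E := ObjectProperty.ι _ ⋙ Arrow.leftFunc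

/-- The codomain functor. -/
abbrev Vert.cod (p : E ⥤ B) : Vert p ⥤ E := ObjectProperty.ι _ ⋙ Arrow.rightFunc

/-! ### Functorial factorisations -/

/-- A functorial factorisation over `p`: each vertical map `f : X ⟶ Y` is factored, functorially
in `f`, as `X ⟶ K f ⟶ Y` with both factors vertical. This is the same as a section
of the composition functor from composable pairs of vertical maps to vertical maps. -/
structure FunctorialFactorisation (p : E ⥤ B) where
  K : Vert p ⥤ E
  left : Vert.dom p ⟶ K
  right : K ⟶ Vert.cod p
  fac : ∀ f : Vert p, left.app f ≫ right.app f = f.obj.hom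
  left_vertical : ∀ f : Vert p, IsVertical p (left.app f)
  right_vertical : ∀ f : Vert p, IsVertical p (right.app f)

namespace FunctorialFactorisation

variable {p : E ⥤ B} (F : FunctorialFactorisation p)

/-- The endofunctor `L` sending `f` to its left factor `L f : X ⟶ K f`. -/
def L : Vert p ⥤ Vert p where
  obj f := ⟨Arrow.mk (F.left.app f), F.left_vertical f⟩
  map φ := ObjectProperty.homMk (Arrow.homMk φ.hom.left (F.K.map φ) (F.left.naturality φ))
  map_id f := by
    ext
    · rfl
    · exact F.K.map_id f
  map_comp φ ψ := by
    ext
    · rfl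
    · exact F.K.map_comp φ ψ

/-- The endofunctor `R` sending `f` to its right factor `R f : K f ⟶ Y`. -/
def R : Vert p ⥤ Vert p where
  obj f := ⟨Arrow.mk (F.right.app f), F.right_vertical f⟩
  map φ := ObjectProperty.homMk (Arrow.homMk (F.K.map φ) φ.hom.right (F.right.naturality φ))
  map_id f := by
    ext
    · exact F.K.map_id f
    · rfl
  map_comp φ ψ := by
    ext
    · exact F.K.map_comp φ ψ
    · rfl

/-- The point of `R`: at `f` it is the square `(L f, 𝟙) : f ⟶ R f`. -/
def unit : 𝟭 (Vert p) ⟶ F.R where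
  app f := ObjectProperty.homMk (Arrow.homMk (F.left.app f) (𝟙 f.obj.right)
    ((F.fac f).trans (Category.comp_id _).symm))
  naturality f g φ := by
    ext
    · exact F.left.naturality φ
    · exact (Category.comp_id _).trans (Category.id_comp _).symm

/-- The copoint of `L`: at `f` it is the square `(𝟙, R f) : L f ⟶ f`. -/
def counit : F.L ⟶ 𝟭 (Vert p) where
  app f := ObjectProperty.homMk (Arrow.homMk (𝟙 f.obj.left) (F.right.app f)
    ((Category.id_comp _).trans (F.fac f).symm))
  naturality f g φ := by
    ext
    · exact (Category.comp_id _).trans (Category.id_comp _).symm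
    · exact F.right.naturality φ

/-- A comultiplication making `(L, counit)` into a comonad over `dom`. -/
structure ComonadStr where
  comul : F.L ⟶ F.L ⋙ F.L
  comul_vertical : ∀ f, IsVertical (Vert.dom p) (comul.app f)
  coassoc : ∀ f, comul.app f ≫ F.L.map (comul.app f) = comul.app f ≫ comul.app (F.L.obj f)
  left_counit : ∀ f, comul.app f ≫ F.counit.app (F.L.obj f) = 𝟙 (F.L.obj f)
  right_counit : ∀ f, comul.app f ≫ F.L.map (F.counit.app f) = 𝟙 (F.L.obj f)

/-- A multiplication making `(R, unit)` into a monad over `cod`. -/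
structure MonadStr where
  mul : F.R ⋙ F.R ⟶ F.R
  mul_vertical : ∀ f, IsVertical (Vert.cod p) (mul.app f)
  assoc : ∀ f, F.R.map (mul.app f) ≫ mul.app f = mul.app (F.R.obj f) ≫ mul.app f
  left_unit : ∀ f, F.unit.app (F.R.obj f) ≫ mul.app f = 𝟙 (F.R.obj f)
  right_unit : ∀ f, F.R.map (F.unit.app f) ≫ mul.app f = 𝟙 (F.R.obj f)

variable {F}

/-- The comonad `(L, counit, comul)` on the category of vertical maps. -/
def ComonadStr.comonad (c : F.ComonadStr) : Comonad (Vert p) where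
  toFunctor := F.L
  ε := F.counit
  δ := c.comul
  coassoc := c.coassoc
  left_counit := c.left_counit
  right_counit := c.right_counit

/-- The monad `(R, unit, mul)` on the category of vertical maps. -/
def MonadStr.monad (m : F.MonadStr) : Monad (Vert p) where
  toFunctor := F.R
  η := F.unit
  μ := m.mul
  assoc := m.assoc
  left_unit := m.left_unit
  right_unit := m.right_unit

/-- The canonical natural transformation `LR ⟶ RL`. At `f` it is the square from
`L (R f) : K f ⟶ K (R f)` to `R (L f) : K (L f) ⟶ K f` whose top is the codomain component
`K f ⟶ K (L f)` of the comultiplication and whose bottom is the domain component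
`K (R f) ⟶ K f` of the multiplication. -/
def canonicalMap (c : F.ComonadStr) (m : F.MonadStr) : F.R ⋙ F.L ⟶ F.L ⋙ F.R where
  app f := ObjectProperty.homMk (Arrow.homMk (c.comul.app f).hom.right (m.mul.app f).hom.left
    ((congrArg (fun φ => φ.hom.right) (c.left_counit f)).trans
      (congrArg (fun φ => φ.hom.left) (m.left_unit f)).symm))
  naturality f g φ := by
    ext
    · exact congrArg (fun ψ => ψ.hom.right) (c.comul.naturality φ)
    · exact congrArg (fun ψ => ψ.hom.left) (m.mul.naturality φ)

/-- A morphism of functorial factorisations: a natural family `K f ⟶ K' f` compatible with the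
left and the right factors, that is, a natural transformation between the two sections
lying over the identity of the category of vertical maps. -/
structure Hom (F G : FunctorialFactorisation p) where
  app : F.K ⟶ G.K
  left_app : F.left ≫ app = G.left
  app_right : app ≫ G.right = F.right

variable {G : FunctorialFactorisation p}

/-- The natural transformation `L ⟶ L'` induced by a morphism of functorial factorisations. -/
def Hom.onL (ξ : Hom F G) : F.L ⟶ G.L where
  app f := ObjectProperty.homMk (Arrow.homMk (𝟙 f.obj.left) (ξ.app.app f)
    ((Category.id_comp _).trans (NatTrans.congr_app ξ.left_app f).symm))
  naturality f g φ := by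
    ext
    · exact (Category.comp_id _).trans (Category.id_comp _).symm
    · exact ξ.app.naturality φ

/-- The natural transformation `R ⟶ R'` induced by a morphism of functorial factorisations. -/
def Hom.onR (ξ : Hom F G) : F.R ⟶ G.R where
  app f := ObjectProperty.homMk (Arrow.homMk (ξ.app.app f) (𝟙 f.obj.right)
    ((NatTrans.congr_app ξ.app_right f).trans (Category.comp_id _).symm))
  naturality f g φ := by
    ext
    · exact ξ.app.naturality φ
    · exact (Category.comp_id _).trans (Category.id_comp _).symm

theorem Hom.unit_onR (ξ : Hom F G) : F.unit ≫ ξ.onR = G.unit := by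
  ext f
  · exact NatTrans.congr_app ξ.left_app f
  · exact Category.comp_id _

end FunctorialFactorisation

/-! ### Lawfs's and awfs's -/

/-- The left half of an algebraic weak factorisation system over `p`: a comonad over
`dom : Vert p ⥤ E`, presented as a functorial factorisation with a comultiplication. -/
structure Lawfs (p : E ⥤ B) where
  ff : FunctorialFactorisation p
  comonadStr : ff.ComonadStr

/-- An algebraic weak factorisation system over `p`. -/
structure Awfs (p : E ⥤ B) where
  ff : FunctorialFactorisation p
  comonadStr : ff.ComonadStr
  monadStr : ff.MonadStr
  distributive : IsDistributiveLaw comonadStr.comonad monadStr.monad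
    (FunctorialFactorisation.canonicalMap comonadStr monadStr)

variable {p : E ⥤ B}

/-- The underlying lawfs of an awfs. -/
def Awfs.toLawfs (W : Awfs p) : Lawfs p := ⟨W.ff, W.comonadStr⟩

/-- A morphism of lawfs's: a morphism of functorial factorisations respecting comultiplication. -/
structure Lawfs.Hom (A A' : Lawfs p) extends FunctorialFactorisation.Hom A.ff A'.ff where
  comul_comp : ∀ f : Vert p, toHom.onL.app f ≫ A'.comonadStr.comul.app f =
    A.comonadStr.comul.app f ≫ toHom.onL.app (A.ff.L.obj f) ≫ A'.ff.L.map (toHom.onL.app f)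

/-- The category of `R`-algebras of a lawfs, where `R` is a pointed endofunctor. -/
abbrev Lawfs.RAlg (A : Lawfs p) := PointedAlgebra A.ff.R A.ff.unit

/-- The forgetful functor from `R`-algebras to vertical maps. -/
abbrev Lawfs.forget (A : Lawfs p) : A.RAlg ⥤ Vert p := PointedAlgebra.forget A.ff.R A.ff.unit

/-- The functor from `R'`-algebras to `R`-algebras induced by a morphism of lawfs's
from `(L, R)` to `(L', R')`. -/
def Lawfs.Hom.algMap {A A' : Lawfs p} (ξ : Lawfs.Hom A A') : A'.RAlg ⥤ A.RAlg :=
  PointedAlgebra.restrict ξ.toHom.onR ξ.toHom.unit_onR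

/-- The functor from algebras for the monad of an awfs to algebras for the underlying pointed
endofunctor. -/
def Awfs.forgetMul (W : Awfs p) : W.monadStr.monad.Algebra ⥤ W.toLawfs.RAlg :=
  PointedAlgebra.ofMonad W.monadStr.monad

/-- The awfs `W` is algebraically free on the lawfs `A`, as witnessed by the lawfs morphism `ξ`:
the composite from algebras for the monad of `W` to algebras for the pointed endofunctor of `W`
to algebras for the pointed endofunctor of `A` is an isomorphism of categories. -/
def IsAlgebraicallyFree (A : Lawfs p) (W : Awfs p) (ξ : Lawfs.Hom A W.toLawfs) : Prop :=
  (W.forgetMul ⋙ ξ.algMap).IsIso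

end FibAwfs

/-! If an awfs is algebraically free, its monad lies over `cod`, and the given isomorphism commutes
with the functors to vertical maps; this is monadicity.

Conversely, let the monad `M` over `cod` have the pointed `R₁`-algebras as its algebras. Identifying
the codomain of `M f` with that of `f` replaces `M` by an isomorphic monad which is the right half
`R` of a functorial factorisation (`IsMonadOver.monadIso`). What is missing is a comultiplication on
`L`. It comes from composition: the comultiplication of `L₁` lets `R₁`-algebras on `f` and `g`
compose to one on `f ≫ g`, unitally, associatively and functorially (`ComonadStr.comp_id`,
`id_comp`, `comp_assoc`, `comp_hom`). The free algebras on `L f` and on `f` therefore compose to an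
algebra on `R (L f) ≫ R f`, and the universal property of the free algebra on `f` extends `L (L f)`
to a map `K f ⟶ K (L f)`.

Most of the remaining laws compare two algebra morphisms out of a free algebra that agree on
generators, so `AlgIso.hom_ext` proves them. The comparison `ξ` applies the `R₁`-structure of the
free algebra on `f` to the unit square, and precomposition with `ξ` recovers the given isomorphism
of algebras (`AlgIso.ξ_str`). -/

namespace FibAwfs

/-! ### Isomorphisms of categories of algebras, expressed through structure maps. -/

section StrictIso

variable {C : Type u} [Category.{v} C] {T : C ⥤ C} {η : 𝟭 C ⟶ T}

/-- The structure map of a pointed algebra, transported to an object equal to its carrier. -/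
def PointedAlgebra.strTo (x : PointedAlgebra T η) {c : C} (h : x.obj.a = c) : T.obj c ⟶ c :=
  T.map (eqToHom h.symm) ≫ x.obj.str ≫ eqToHom h

theorem PointedAlgebra.unit_strTo (x : PointedAlgebra T η) {c : C} (h : x.obj.a = c) :
    η.app c ≫ x.strTo h = 𝟙 c := by
  subst h
  simpa [strTo] using x.property

theorem PointedAlgebra.mk_strTo {f : C} (β : T.obj f ⟶ f) (hβ : η.app f ≫ β = 𝟙 f)
    (x : PointedAlgebra T η) (h : x.obj.a = f) (hx : x = ⟨⟨f, β⟩, hβ⟩) : x.strTo h = β := by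
  subst hx
  simp [strTo]

/-- Carriers are known only up to propositional equality; after substituting it, both sides are the
algebra morphism equation. -/
theorem PointedAlgebra.strTo_hom_iff {x y : PointedAlgebra T η} {c d : C} (h : x.obj.a = c)
    (h' : y.obj.a = d) (φ : c ⟶ d) :
    T.map φ ≫ y.strTo h' = x.strTo h ≫ φ ↔
      ∃ ψ : x ⟶ y, ψ.hom.f = eqToHom h ≫ φ ≫ eqToHom h'.symm := by
  subst h h'
  simp only [strTo, eqToHom_refl, Category.comp_id, Category.id_comp, CategoryTheory.Functor.map_id]
  constructor
  · intro hφ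
    exact ⟨ObjectProperty.homMk ⟨φ, hφ⟩, rfl⟩
  · rintro ⟨ψ, rfl⟩
    exact ψ.hom.h

/-- An isomorphism over `C` between the algebras of a monad `M` and the algebras of a pointed
endofunctor `(T, η)`, presented by its effect on structure maps. -/
structure StrictAlgIso (T : C ⥤ C) (η : 𝟭 C ⟶ T) (M : Monad C) where
  str : ∀ y : M.Algebra, T.obj y.A ⟶ y.A
  unit : ∀ y : M.Algebra, η.app y.A ≫ str y = 𝟙 y.A
  hom_iff : ∀ (y z : M.Algebra) (φ : y.A ⟶ z.A),
    M.map φ ≫ z.a = y.a ≫ φ ↔ T.map φ ≫ str z = str y ≫ φ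
  surj : ∀ (f : C) (β : T.obj f ⟶ f), η.app f ≫ β = 𝟙 f →
    ∃ (a : M.obj f ⟶ f) (h₁ : M.η.app f ≫ a = 𝟙 f) (h₂ : M.μ.app f ≫ a = M.map a ≫ a),
      str ⟨f, a, h₁, h₂⟩ = β

theorem algebra_carrier_eq_of_comp_forget {M : Monad C} {Ψ : M.Algebra ⥤ PointedAlgebra T η}
    (hΨ : Ψ ⋙ PointedAlgebra.forget T η = M.forget) (y : M.Algebra) :
    (Ψ.obj y).obj.a = y.A :=
  Functor.congr_obj hΨ y

theorem algebra_hom_eq_of_comp_forget {M : Monad C} {Ψ : M.Algebra ⥤ PointedAlgebra T η}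
    (hΨ : Ψ ⋙ PointedAlgebra.forget T η = M.forget) {y z : M.Algebra} (φ : y ⟶ z)
    (hy : (Ψ.obj y).obj.a = y.A) (hz : (Ψ.obj z).obj.a = z.A) :
    (Ψ.map φ).hom.f = eqToHom hy ≫ φ.f ≫ eqToHom hz.symm :=
  Functor.congr_hom hΨ φ

/-- The presentation by structure maps of an isomorphism of categories over `C`. -/
def StrictAlgIso.ofFunctor {M : Monad C} (Ψ : M.Algebra ⥤ PointedAlgebra T η) [Ψ.IsIso]
    (hΨ : Ψ ⋙ PointedAlgebra.forget T η = M.forget) : StrictAlgIso T η M where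
  str y := (Ψ.obj y).strTo (algebra_carrier_eq_of_comp_forget hΨ y)
  unit y := (Ψ.obj y).unit_strTo _
  hom_iff y z φ := by
    rw [PointedAlgebra.strTo_hom_iff]
    constructor
    · intro h
      exact ⟨Ψ.map (⟨φ, h⟩ : y ⟶ z), algebra_hom_eq_of_comp_forget hΨ _
        (algebra_carrier_eq_of_comp_forget hΨ y) (algebra_carrier_eq_of_comp_forget hΨ z)⟩
    · rintro ⟨ψ, hψ⟩
      -- Fullness provides a morphism of `M`-algebras, and its underlying map must be `φ` since `Ψ`
      -- lies over `C`.
      obtain ⟨χ, rfl⟩ := Ψ.map_surjective ψ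
      rw [algebra_hom_eq_of_comp_forget hΨ _ (algebra_carrier_eq_of_comp_forget hΨ y)
        (algebra_carrier_eq_of_comp_forget hΨ z),
        cancel_epi, cancel_mono] at hψ
      rw [← hψ]
      exact χ.h
  surj f β hβ := by
    obtain ⟨y, hy⟩ := Ψ.bijective_obj.2 (⟨⟨f, β⟩, hβ⟩ : PointedAlgebra T η)
    have hf : y.A = f := (algebra_carrier_eq_of_comp_forget hΨ y).symm.trans
      (congrArg (fun x => x.obj.a) hy)
    obtain ⟨f', a, h₁, h₂⟩ := y
    dsimp only at hf
    subst hf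
    exact ⟨a, h₁, h₂, PointedAlgebra.mk_strTo β hβ _ _ hy⟩

/-- Transport of the presentation along an isomorphism of monads. -/
def StrictAlgIso.transport {M N : Monad C} (S : StrictAlgIso T η M) (i : M ≅ N) :
    StrictAlgIso T η N where
  str y := S.str ((Monad.algebraFunctorOfMonadHom i.hom).obj y)
  unit y := S.unit ((Monad.algebraFunctorOfMonadHom i.hom).obj y)
  hom_iff y z φ := by
    refine Iff.trans ?_ (S.hom_iff ((Monad.algebraFunctorOfMonadHom i.hom).obj y)
      ((Monad.algebraFunctorOfMonadHom i.hom).obj z) φ)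
    have hi : IsIso (i.hom.app y.A) :=
      inferInstanceAs (IsIso (((monadToFunctor C).mapIso i).hom.app y.A))
    change _ ↔ M.map φ ≫ i.hom.app z.A ≫ z.a = (i.hom.app y.A ≫ y.a) ≫ φ
    rw [← Category.assoc, i.hom.naturality, Category.assoc, Category.assoc, cancel_epi]
  surj f β hβ := by
    obtain ⟨a, h₁, h₂, h⟩ := S.surj f β hβ
    have hi : i.hom.app f ≫ i.inv.app f = 𝟙 _ :=
      congrArg (fun t : M ⟶ M => t.app f) i.hom_inv_id
    let z := (Monad.algebraFunctorOfMonadHom i.inv).obj ⟨f, a, h₁, h₂⟩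
    refine ⟨z.a, z.unit, z.assoc, ?_⟩
    -- The algebra laws depend on the structure map, so the equality is substituted for a generic
    -- map.
    have key : ∀ (a' : M.obj f ⟶ f) (h₁' : M.η.app f ≫ a' = 𝟙 f)
        (h₂' : M.μ.app f ≫ a' = M.map a' ≫ a'), a' = a → S.str ⟨f, a', h₁', h₂'⟩ = β := by
      rintro _ _ _ rfl
      exact h
    refine key _ _ _ ?_
    change i.hom.app f ≫ i.inv.app f ≫ a = a
    rw [reassoc_of% hi]

/-- A functor over `C` acting on objects as a strict isomorphism is an isomorphism. -/
theorem StrictAlgIso.isIso_of_str {M : Monad C} (S : StrictAlgIso T η M)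
    (J : M.Algebra ⥤ PointedAlgebra T η) (hobj : ∀ y, J.obj y = ⟨⟨y.A, S.str y⟩, S.unit y⟩)
    (hJ : J ⋙ PointedAlgebra.forget T η = M.forget) : J.IsIso := by
  have e := algebra_carrier_eq_of_comp_forget hJ
  have es (y : M.Algebra) : (J.obj y).strTo (e y) = S.str y :=
    PointedAlgebra.mk_strTo _ (S.unit y) _ _ (hobj y)
  refine ⟨⟨fun {y z} φ ψ h => ?_⟩, ⟨fun {y z} ψ => ?_⟩, fun y z h => ?_, fun x => ?_⟩
  · have := congrArg (fun t => t.hom.f) h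
    rw [algebra_hom_eq_of_comp_forget hJ _ (e y) (e z),
      algebra_hom_eq_of_comp_forget hJ _ (e y) (e z), cancel_epi, cancel_mono] at this
    exact Monad.Algebra.Hom.ext this
  · have h := (PointedAlgebra.strTo_hom_iff (e y) (e z)
      (eqToHom (e y).symm ≫ ψ.hom.f ≫ eqToHom (e z))).2 ⟨ψ, by simp⟩
    rw [es, es, ← S.hom_iff] at h
    refine ⟨⟨_, h⟩, ?_⟩
    ext : 2
    rw [algebra_hom_eq_of_comp_forget hJ _ (e y) (e z)]
    simp
  · rw [hobj, hobj] at h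
    obtain ⟨f, a, h₁, h₂⟩ := y
    obtain ⟨f', a', h₁', h₂'⟩ := z
    have hf : f = f' := congrArg (fun t => t.obj.a) h
    subst hf
    have hs : S.str ⟨f, a, h₁, h₂⟩ = S.str ⟨f, a', h₁', h₂'⟩ := by
      have := congrArg ObjectProperty.FullSubcategory.obj h
      exact eq_of_heq (Endofunctor.Algebra.mk.inj this).2
    -- Injectivity on objects: the identity respects the pointed structures, hence the monad
    -- structures, which forces these to agree.
    have := (S.hom_iff ⟨f, a, h₁, h₂⟩ ⟨f, a', h₁', h₂'⟩ (𝟙 f)).2 (by simp [hs])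
    have : a' = a := by simpa using this
    subst this
    rfl
  · obtain ⟨⟨f, β⟩, hβ⟩ := x
    obtain ⟨a, h₁, h₂, h⟩ := S.surj f β hβ
    subst h
    exact ⟨⟨f, a, h₁, h₂⟩, hobj _⟩

end StrictIso

/-! ### The forward implication, and calculus of vertical maps. -/

variable {E : Type u} [Category.{v} E] {B : Type u'} [Category.{v'} B] {p : E ⥤ B}

theorem IsAlgebraicallyFree.isMonadicOver {A : Lawfs p} {W : Awfs p}
    {ξ : Lawfs.Hom A W.toLawfs} (h : IsAlgebraicallyFree A W ξ) :
    IsMonadicOver A.forget (Vert.cod p) := by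
  have : (W.forgetMul ⋙ ξ.algMap).IsIso := h
  refine ⟨W.monadStr.monad, ⟨rfl, fun f => ?_, W.monadStr.mul_vertical⟩,
    (W.forgetMul ⋙ ξ.algMap).asIsomorphism.symm, ?_⟩
  · change (Vert.cod p).IsHomLift ((Vert.cod p).map (W.monadStr.monad.η.app f)) _
    infer_instance
  · exact congrArg (· ⋙ A.forget) (W.forgetMul ⋙ ξ.algMap).asIsomorphism.counit_eq

theorem isVertical_iff {F : Type u} [Category.{v} F] {E : Type u'} [Category.{v'} E] (q : F ⥤ E)
    {X Y : F} (f : X ⟶ Y) :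
    IsVertical q f ↔ ∃ h : q.obj X = q.obj Y, q.map f = eqToHom h := by
  constructor
  · intro (hf : q.IsHomLift _ _)
    exact ⟨(IsHomLift.codomain_eq q (𝟙 (q.obj X)) f).symm, by
      rw [IsHomLift.fac' q (𝟙 (q.obj X)) f]; simp⟩
  · rintro ⟨h, hf⟩
    exact IsHomLift.of_fac' _ _ _ rfl h.symm (by simp [hf])

theorem IsVertical.comp {F : Type u} [Category.{v} F] {E : Type u'} [Category.{v'} E] {q : F ⥤ E}
    {X Y Z : F} {f : X ⟶ Y} {g : Y ⟶ Z} (hf : IsVertical q f) (hg : IsVertical q g) :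
    IsVertical q (f ≫ g) := by
  rw [isVertical_iff] at *
  obtain ⟨h, hf⟩ := hf
  obtain ⟨h', hg⟩ := hg
  exact ⟨h.trans h', by simp [hf, hg]⟩

/-- The image of `g` is an `eqToHom`, hence can be cancelled. This makes the left factor of a
vertical map vertical once the right factor is. -/
theorem IsVertical.of_comp {F : Type u} [Category.{v} F] {E : Type u'} [Category.{v'} E]
    {q : F ⥤ E} {X Y Z : F} {f : X ⟶ Y} {g : Y ⟶ Z} (hfg : IsVertical q (f ≫ g))
    (hg : IsVertical q g) : IsVertical q f := by
  rw [isVertical_iff] at *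
  obtain ⟨h, hf⟩ := hfg
  obtain ⟨h', hg⟩ := hg
  refine ⟨h.trans h'.symm, ?_⟩
  rw [q.map_comp, hg] at hf
  rw [← cancel_mono (eqToHom h'), hf]
  simp

theorem isVertical_eqToHom {F : Type u} [Category.{v} F] {E : Type u'} [Category.{v'} E]
    (q : F ⥤ E) {X Y : F} (h : X = Y) : IsVertical q (eqToHom h) := by
  subst h
  exact (isVertical_iff _ _).2 ⟨rfl, by simp⟩

theorem _root_.CategoryTheory.Monad.mul_comp_transport {C : Type u} [Category.{v} C]
    (M : Monad C) {T : C ⥤ C} (i : M.toFunctor ≅ T) (X : C) :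
    M.μ.app X ≫ i.hom.app X =
      (M.map (i.hom.app X) ≫ i.hom.app (T.obj X)) ≫ (M.transport i).μ.app X := by
  simp [Monad.transport, ← Functor.map_comp_assoc]

/-! ### From a monad over `cod` to a functorial factorisation. -/

namespace IsMonadOver

variable {M : Monad (Vert p)} (h : IsMonadOver M (Vert.cod p))
include h

theorem cod_eq (f : Vert p) : (M.obj f).obj.right = f.obj.right :=
  Functor.congr_obj h.comp_eq f

theorem map_right {f g : Vert p} (φ : f ⟶ g) :
    (M.map φ).hom.right ≫ eqToHom (h.cod_eq g) = eqToHom (h.cod_eq f) ≫ φ.hom.right := by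
  have : (M.map φ).hom.right = eqToHom (h.cod_eq f) ≫ φ.hom.right ≫ eqToHom (h.cod_eq g).symm :=
    Functor.congr_hom h.comp_eq φ
  rw [this]
  simp

theorem unit_right (f : Vert p) : (M.η.app f).hom.right ≫ eqToHom (h.cod_eq f) = 𝟙 _ := by
  obtain ⟨h₁, h₂⟩ := (isVertical_iff _ _).1 (h.unit_vertical f)
  have h₂ : (M.η.app f).hom.right = eqToHom h₁ := h₂
  rw [h₂]
  exact (eqToHom_trans _ _).trans rfl

theorem mul_right (f : Vert p) :
    (M.μ.app f).hom.right ≫ eqToHom (h.cod_eq f) =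
      eqToHom (h.cod_eq (M.obj f)) ≫ eqToHom (h.cod_eq f) := by
  obtain ⟨h₁, h₂⟩ := (isVertical_iff _ _).1 (h.mul_vertical f)
  have h₂ : (M.μ.app f).hom.right = eqToHom h₁ := h₂
  rw [h₂]
  exact (eqToHom_trans _ _).trans (eqToHom_trans _ _).symm

theorem right_naturality {f g : Vert p} (φ : f ⟶ g) :
    (M.map φ).hom.left ≫ (M.obj g).obj.hom ≫ eqToHom (h.cod_eq g) =
      ((M.obj f).obj.hom ≫ eqToHom (h.cod_eq f)) ≫ φ.hom.right := by
  have h₁ : (M.map φ).hom.left ≫ (M.obj g).obj.hom =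
    (M.obj f).obj.hom ≫ (M.map φ).hom.right := Arrow.w (M.map φ).hom
  rw [reassoc_of% h₁, h.map_right, Category.assoc]

theorem unit_left_comp (f : Vert p) :
    (M.η.app f).hom.left ≫ (M.obj f).obj.hom ≫ eqToHom (h.cod_eq f) = f.obj.hom := by
  have h₁ : (M.η.app f).hom.left ≫ (M.obj f).obj.hom = f.obj.hom ≫ (M.η.app f).hom.right :=
    Arrow.w (M.η.app f).hom
  rw [reassoc_of% h₁]
  exact (congrArg (f.obj.hom ≫ ·) (h.unit_right f)).trans (Category.comp_id _)

/-- The functorial factorisation given by a monad over the codomain functor. -/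
def factorisation : FunctorialFactorisation p where
  K := M.toFunctor ⋙ Vert.dom p
  left :=
    { app := fun f => (M.η.app f).hom.left
      naturality := fun _ _ φ => congrArg (fun t => t.hom.left) (M.η.naturality φ) }
  right :=
    { app := fun f => (M.obj f).obj.hom ≫ eqToHom (h.cod_eq f)
      naturality := fun f g φ => h.right_naturality φ }
  fac f := h.unit_left_comp f
  left_vertical f := by
    refine IsVertical.of_comp (g := (M.obj f).obj.hom ≫ eqToHom (h.cod_eq f)) ?_
      ((M.obj f).property.comp (isVertical_eqToHom _ _))
    exact (h.unit_left_comp f).symm ▸ f.property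
  right_vertical f := (M.obj f).property.comp (isVertical_eqToHom _ _)

/-- The monad is isomorphic to the right part of its factorisation, by identifying codomains. -/
def rightIso : M.toFunctor ≅ h.factorisation.R :=
  NatIso.ofComponents
    (fun f => ObjectProperty.isoMk _ (Arrow.isoMk (Iso.refl _) (eqToIso (h.cod_eq f))
      (Category.id_comp _)))
    (fun {f g} φ => by
      ext
      · exact (Category.comp_id _).trans (Category.id_comp _).symm
      · exact h.map_right φ)

theorem unit_rightIso : M.η ≫ h.rightIso.hom = h.factorisation.unit := by
  ext f
  · exact Category.comp_id _
  · exact h.unit_right f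

/-- Every codomain component involved is a transport along an equality of objects, and these cancel.
-/
theorem transport_mul_right (f : Vert p) :
    ((M.transport h.rightIso).μ.app f).hom.right = 𝟙 f.obj.right := by
  have h₁ := h.map_right (h.rightIso.inv.app f)
  have h₂ := h.mul_right f
  have e₁ (g : Vert p) : (h.rightIso.inv.app g).hom.right = eqToHom (h.cod_eq g).symm := rfl
  have e₂ : ((M.transport h.rightIso).μ.app f).hom.right =
    ((h.rightIso.inv.app (h.factorisation.R.obj f)).hom.right ≫
      (M.map (h.rightIso.inv.app f)).hom.right) ≫ (M.μ.app f).hom.right ≫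
        eqToHom (h.cod_eq f) := rfl
  rw [e₁] at h₁
  rw [e₂, h₂, Category.assoc, reassoc_of% h₁, e₁]
  have h₃ : ∀ {X Y Z : E} (e : X = Y) (e' : Z = Y),
    eqToHom e.symm ≫ (eqToHom e ≫ eqToHom e'.symm) ≫ eqToHom e' = 𝟙 _ := by
      intros; simp
  exact (h₃ _ _).trans rfl

/-- The monad structure on the right part of the factorisation. -/
def monadStr : h.factorisation.MonadStr where
  mul := (M.transport h.rightIso).μ
  mul_vertical f := (isVertical_iff _ _).2 ⟨rfl, h.transport_mul_right f⟩
  assoc := (M.transport h.rightIso).assoc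
  left_unit f := by
    have := (M.transport h.rightIso).left_unit f
    rw [← h.unit_rightIso]
    exact this
  right_unit f := by
    have := (M.transport h.rightIso).right_unit f
    rw [← h.unit_rightIso]
    exact this

/-- The monad is isomorphic to the monad of its factorisation. -/
def monadIso : M ≅ h.monadStr.monad :=
  MonadIso.mk h.rightIso (fun f => NatTrans.congr_app h.unit_rightIso f)
    (fun f => M.mul_comp_transport h.rightIso f)

end IsMonadOver

theorem IsMonadicOver.exists_strictAlgIso {A : Lawfs p}
    (h : IsMonadicOver A.forget (Vert.cod p)) :
    ∃ (F : FunctorialFactorisation p) (m : F.MonadStr),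
      Nonempty (StrictAlgIso A.ff.R A.ff.unit m.monad) := by
  obtain ⟨M, hM, Φ, hΦ⟩ := h
  refine ⟨hM.factorisation, hM.monadStr, ⟨(StrictAlgIso.ofFunctor Φ.inverse ?_).transport
    hM.monadIso⟩⟩
  exact (congrArg (Φ.inverse ⋙ ·) hΦ.symm).trans (congrArg (· ⋙ M.forget) Φ.counit_eq)

/-! ### Factorisations in components, and vertical composition of algebras. -/

/-- A vertical map as an object of the category of vertical maps. -/
abbrev Vert.mk {X Y : E} (f : X ⟶ Y) (hf : IsVertical p f) : Vert p := ⟨Arrow.mk f, hf⟩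

/-- A commutative square as a morphism of vertical maps. -/
abbrev Vert.homMk {X Y X' Y' : E} {f : X ⟶ Y} {g : X' ⟶ Y'} (hf : IsVertical p f)
    (hg : IsVertical p g) (u : X ⟶ X') (v : Y ⟶ Y') (w : u ≫ g = f ≫ v) :
    Vert.mk f hf ⟶ Vert.mk g hg :=
  ObjectProperty.homMk (Arrow.homMk u v w)

namespace FunctorialFactorisation

variable (F : FunctorialFactorisation p) {X Y X' Y' X'' Y'' : E}

/-- The middle object of the factorisation of a vertical map. -/
abbrev k (f : X ⟶ Y) (hf : IsVertical p f) : E := F.K.obj (Vert.mk f hf)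

/-- The left factor of a vertical map. -/
def l (f : X ⟶ Y) (hf : IsVertical p f) : X ⟶ F.k f hf := F.left.app (Vert.mk f hf)

/-- The right factor of a vertical map. -/
def r (f : X ⟶ Y) (hf : IsVertical p f) : F.k f hf ⟶ Y := F.right.app (Vert.mk f hf)

theorem hl (f : X ⟶ Y) (hf : IsVertical p f) : IsVertical p (F.l f hf) := F.left_vertical _

theorem hr (f : X ⟶ Y) (hf : IsVertical p f) : IsVertical p (F.r f hf) := F.right_vertical _

@[simp]
theorem l_r (f : X ⟶ Y) (hf : IsVertical p f) : F.l f hf ≫ F.r f hf = f := F.fac _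

@[simp]
theorem l_r_assoc (f : X ⟶ Y) (hf : IsVertical p f) {T : E} (q : Y ⟶ T) :
    F.l f hf ≫ F.r f hf ≫ q = f ≫ q := by
  rw [← Category.assoc, l_r]

section kmap

variable {f : X ⟶ Y} {g : X' ⟶ Y'} {h : X'' ⟶ Y''} {hf : IsVertical p f} {hg : IsVertical p g}
  {hh : IsVertical p h}

/-- The action of a factorisation on squares. -/
def kmap (hf : IsVertical p f) (hg : IsVertical p g) (u : X ⟶ X') (v : Y ⟶ Y')
    (w : u ≫ g = f ≫ v) : F.k f hf ⟶ F.k g hg :=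
  F.K.map (Vert.homMk hf hg u v w)

theorem l_kmap (u : X ⟶ X') (v : Y ⟶ Y') (w : u ≫ g = f ≫ v) :
    F.l f hf ≫ F.kmap hf hg u v w = u ≫ F.l g hg :=
  (F.left.naturality (Vert.homMk hf hg u v w)).symm

theorem l_kmap_assoc (u : X ⟶ X') (v : Y ⟶ Y') (w : u ≫ g = f ≫ v) {T : E} (q : F.k g hg ⟶ T) :
    F.l f hf ≫ F.kmap hf hg u v w ≫ q = u ≫ F.l g hg ≫ q := by
  rw [← Category.assoc, l_kmap, Category.assoc]

theorem kmap_r (u : X ⟶ X') (v : Y ⟶ Y') (w : u ≫ g = f ≫ v) :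
    F.kmap hf hg u v w ≫ F.r g hg = F.r f hf ≫ v :=
  F.right.naturality (Vert.homMk hf hg u v w)

theorem kmap_r_assoc (u : X ⟶ X') (v : Y ⟶ Y') (w : u ≫ g = f ≫ v) {T : E} (q : Y' ⟶ T) :
    F.kmap hf hg u v w ≫ F.r g hg ≫ q = F.r f hf ≫ v ≫ q := by
  rw [← Category.assoc, kmap_r, Category.assoc]

theorem kmap_comp (u : X ⟶ X') (v : Y ⟶ Y') (w : u ≫ g = f ≫ v) (u' : X' ⟶ X'') (v' : Y' ⟶ Y'')
    (w' : u' ≫ h = g ≫ v') :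
    F.kmap hf hg u v w ≫ F.kmap hg hh u' v' w' =
      F.kmap hf hh (u ≫ u') (v ≫ v') (by rw [Category.assoc, w', reassoc_of% w]) :=
  (F.K.map_comp _ _).symm

theorem kmap_comp_assoc (u : X ⟶ X') (v : Y ⟶ Y') (w : u ≫ g = f ≫ v) (u' : X' ⟶ X'')
    (v' : Y' ⟶ Y'') (w' : u' ≫ h = g ≫ v') {T : E} (q : F.k h hh ⟶ T) :
    F.kmap hf hg u v w ≫ F.kmap hg hh u' v' w' ≫ q =
      F.kmap hf hh (u ≫ u') (v ≫ v') (by rw [Category.assoc, w', reassoc_of% w]) ≫ q := by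
  rw [← Category.assoc, kmap_comp]

theorem kmap_id (w : 𝟙 X ≫ f = f ≫ 𝟙 Y) : F.kmap hf hf (𝟙 X) (𝟙 Y) w = 𝟙 _ :=
  F.K.map_id _

theorem kmap_congr {u u' : X ⟶ X'} {v v' : Y ⟶ Y'} {w : u ≫ g = f ≫ v} (hu : u = u')
    (hv : v = v') :
    F.kmap hf hg u v w = F.kmap hf hg u' v' (by rw [← hu, ← hv, w]) := by
  subst hu hv
  rfl

end kmap

/-- An algebra structure on a vertical map for the pointed endofunctor `R`. -/
structure Alg (f : X ⟶ Y) (hf : IsVertical p f) where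
  str : F.k f hf ⟶ X
  unit : F.l f hf ≫ str = 𝟙 X
  fac : str ≫ f = F.r f hf

variable {F}

theorem Alg.fac_assoc {f : X ⟶ Y} {hf : IsVertical p f} (a : F.Alg f hf) {T : E} (q : Y ⟶ T) :
    a.str ≫ f ≫ q = F.r f hf ≫ q := by
  rw [← Category.assoc, a.fac]

@[ext]
theorem Alg.ext' {f : X ⟶ Y} {hf : IsVertical p f} {a b : F.Alg f hf} (h : a.str = b.str) :
    a = b := by
  cases a; cases b; cases h; rfl

variable (F) in
/-- The algebra structure on an identity. -/
@[simps]
def Alg.id (Y : E) (hY : IsVertical p (𝟙 Y)) : F.Alg (𝟙 Y) hY where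
  str := F.r _ _
  unit := F.l_r _ _
  fac := Category.comp_id _

namespace ComonadStr

variable (c : F.ComonadStr) {f : X ⟶ Y} {g : X' ⟶ Y'} {hf : IsVertical p f} {hg : IsVertical p g}

/-- The codomain component of the comultiplication. -/
def s (f : X ⟶ Y) (hf : IsVertical p f) : F.k f hf ⟶ F.k (F.l f hf) (F.hl f hf) :=
  (c.comul.app (Vert.mk f hf)).hom.right

theorem comul_left (f : Vert p) : (c.comul.app f).hom.left = 𝟙 f.obj.left := by
  obtain ⟨h₁, h₂⟩ := (isVertical_iff _ _).1 (c.comul_vertical f)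
  exact h₂.trans (eqToHom_refl _ _)

theorem comul_app (f : X ⟶ Y) (hf : IsVertical p f) (w) :
    c.comul.app (Vert.mk f hf) = Vert.homMk (F.hl f hf) (F.hl _ _) (𝟙 X) (c.s f hf) w := by
  ext
  · exact c.comul_left _
  · rfl

@[simp]
theorem l_s (f : X ⟶ Y) (hf : IsVertical p f) : F.l f hf ≫ c.s f hf = F.l _ (F.hl f hf) := by
  have := Arrow.w (c.comul.app (Vert.mk f hf)).hom
  rw [c.comul_left] at this
  exact this.symm.trans (Category.id_comp _)

@[simp]
theorem l_s_assoc (f : X ⟶ Y) (hf : IsVertical p f) {T : E} (q : F.k _ (F.hl f hf) ⟶ T) :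
    F.l f hf ≫ c.s f hf ≫ q = F.l _ (F.hl f hf) ≫ q := by
  rw [← Category.assoc, l_s]

theorem kmap_s (u : X ⟶ X') (v : Y ⟶ Y') (w : u ≫ g = f ≫ v) :
    F.kmap hf hg u v w ≫ c.s g hg = c.s f hf ≫
      F.kmap (F.hl f hf) (F.hl g hg) u (F.kmap hf hg u v w) (F.l_kmap u v w).symm :=
  congrArg (fun t => t.hom.right) (c.comul.naturality (Vert.homMk hf hg u v w))

theorem kmap_s_assoc (u : X ⟶ X') (v : Y ⟶ Y') (w : u ≫ g = f ≫ v) {T : E}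
    (q : F.k _ (F.hl g hg) ⟶ T) :
    F.kmap hf hg u v w ≫ c.s g hg ≫ q = c.s f hf ≫
      F.kmap (F.hl f hf) (F.hl g hg) u (F.kmap hf hg u v w) (F.l_kmap u v w).symm ≫ q := by
  rw [← Category.assoc, kmap_s, Category.assoc]

@[simp]
theorem s_r (f : X ⟶ Y) (hf : IsVertical p f) : c.s f hf ≫ F.r _ (F.hl f hf) = 𝟙 _ :=
  congrArg (fun t => t.hom.right) (c.left_counit (Vert.mk f hf))

@[simp]
theorem s_r_assoc (f : X ⟶ Y) (hf : IsVertical p f) {T : E} (q : F.k f hf ⟶ T) :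
    c.s f hf ≫ F.r _ (F.hl f hf) ≫ q = q := by
  rw [← Category.assoc, s_r, Category.id_comp]

theorem s_kmap_r (f : X ⟶ Y) (hf : IsVertical p f) (w : 𝟙 X ≫ f = F.l f hf ≫ F.r f hf) :
    c.s f hf ≫ F.kmap (F.hl f hf) hf (𝟙 X) (F.r f hf) w = 𝟙 _ :=
  congrArg (fun t => t.hom.right) (c.right_counit (Vert.mk f hf))

theorem s_kmap_r_assoc (f : X ⟶ Y) (hf : IsVertical p f) (w : 𝟙 X ≫ f = F.l f hf ≫ F.r f hf)
    {T : E} (q : F.k f hf ⟶ T) :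
    c.s f hf ≫ F.kmap (F.hl f hf) hf (𝟙 X) (F.r f hf) w ≫ q = q := by
  rw [← Category.assoc, s_kmap_r, Category.id_comp]

theorem s_kmap_s (f : X ⟶ Y) (hf : IsVertical p f)
    (w : 𝟙 X ≫ F.l _ (F.hl f hf) = F.l f hf ≫ c.s f hf) :
    c.s f hf ≫ F.kmap (F.hl f hf) (F.hl _ (F.hl f hf)) (𝟙 X) (c.s f hf) w =
      c.s f hf ≫ c.s _ (F.hl f hf) := by
  have := congrArg (fun t => t.hom.right) (c.coassoc (Vert.mk f hf))
  rw [c.comul_app f hf w] at this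
  exact this

theorem s_kmap_s_assoc (f : X ⟶ Y) (hf : IsVertical p f)
    (w : 𝟙 X ≫ F.l _ (F.hl f hf) = F.l f hf ≫ c.s f hf) {T : E}
    (q : F.k _ (F.hl _ (F.hl f hf)) ⟶ T) :
    c.s f hf ≫ F.kmap (F.hl f hf) (F.hl _ (F.hl f hf)) (𝟙 X) (c.s f hf) w ≫ q =
      c.s f hf ≫ c.s _ (F.hl f hf) ≫ q := by
  rw [← Category.assoc, s_kmap_s, Category.assoc]

variable {Z X₁ Y₁ Z₁ : E}

section comp

variable {f : X ⟶ Y} {g : Y ⟶ Z} {h : X ⟶ Z}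
  {hf : IsVertical p f} {hg : IsVertical p g} {hh : IsVertical p h}

theorem comp_aux (b : F.Alg g hg) (e : f ≫ g = h) :
    𝟙 X ≫ f = F.l h hh ≫ F.kmap hh hg f (𝟙 Z) (e.trans (Category.comp_id h).symm) ≫ b.str := by
  rw [F.l_kmap_assoc, b.unit, Category.comp_id, Category.id_comp]

/-- The composite of algebras, on a composite of vertical maps. -/
@[simps]
def comp (hh : IsVertical p h) (a : F.Alg f hf) (b : F.Alg g hg) (e : f ≫ g = h) :
    F.Alg h hh where
  -- Applying `b` first gives a map from the middle object of `h` to `Y`, that is, a square from the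
  -- left factor of `h` to `f`. The comultiplication moves into the middle object of that left
  -- factor, where `a` can be applied.
  str := c.s h hh ≫ F.kmap (F.hl h hh) hf (𝟙 X) (F.kmap hh hg f (𝟙 Z)
    (e.trans (Category.comp_id h).symm) ≫ b.str) (comp_aux b e) ≫ a.str
  unit := by rw [c.l_s_assoc, F.l_kmap_assoc, a.unit, Category.comp_id]
  fac := by
    have : F.r h hh = (c.s h hh ≫ F.r _ (F.hl h hh)) ≫
      F.kmap hh hg f (𝟙 Z) (e.trans (Category.comp_id h).symm) ≫ b.str ≫ g := by
      rw [b.fac, kmap_r, c.s_r, Category.comp_id, Category.id_comp]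
    rw [this]
    simp only [Category.assoc, ← e, a.fac_assoc, F.kmap_r_assoc]

theorem comp_hom {f' : X₁ ⟶ Y₁} {g' : Y₁ ⟶ Z₁} {h' : X₁ ⟶ Z₁}
    {hf' : IsVertical p f'} {hg' : IsVertical p g'} {hh' : IsVertical p h'}
    (a : F.Alg f hf) (b : F.Alg g hg) (e : f ≫ g = h)
    (a' : F.Alg f' hf') (b' : F.Alg g' hg') (e' : f' ≫ g' = h')
    {u : X ⟶ X₁} {v : Y ⟶ Y₁} {t : Z ⟶ Z₁} (w : u ≫ f' = f ≫ v) (w' : v ≫ g' = g ≫ t)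
    (w'' : u ≫ h' = h ≫ t)
    (H : a.str ≫ u = F.kmap hf hf' u v w ≫ a'.str)
    (H' : b.str ≫ v = F.kmap hg hg' v t w' ≫ b'.str) :
    (c.comp hh a b e).str ≫ u = F.kmap hh hh' u t w'' ≫ (c.comp hh' a' b' e').str := by
  simp only [comp_str, Category.assoc, H, kmap_s_assoc, kmap_comp_assoc]
  congr 2
  refine F.kmap_congr (by simp) ?_
  rw [H', kmap_comp_assoc]
  congr 1
  exact F.kmap_congr w.symm (by simp)

/-- This is the right counit law; `id_comp` likewise uses the left one. -/
theorem comp_id (a : F.Alg f hf) (hY : IsVertical p (𝟙 Y)) :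
    c.comp hf a (Alg.id F Y hY) (Category.comp_id f) = a := by
  ext
  have h : F.kmap hf hY f (𝟙 Y) (by simp) ≫ (Alg.id F Y hY).str = F.r f hf := by simp [kmap_r]
  simp only [comp_str, h]
  rw [s_kmap_r_assoc]

theorem id_comp (a : F.Alg f hf) (hX : IsVertical p (𝟙 X)) :
    c.comp hf (Alg.id F X hX) a (Category.id_comp f) = a := by
  ext
  simp [kmap_r, kmap_id]

theorem comp_assoc {T : E} {j : Z ⟶ T} {gj : Y ⟶ T} {hj : X ⟶ T} {vj : IsVertical p j}
    {vgj : IsVertical p gj} {vhj : IsVertical p hj} (a : F.Alg f hf) (b : F.Alg g hg)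
    (d : F.Alg j vj) (e : f ≫ g = h) (e₁ : h ≫ j = hj) (e₂ : g ≫ j = gj) (e₃ : f ≫ gj = hj) :
    c.comp vhj (c.comp hh a b e) d e₁ = c.comp vhj a (c.comp vgj b d e₂) e₃ := by
  ext
  simp only [comp_str, Category.assoc, kmap_s_assoc, kmap_comp_assoc]
  -- Coassociativity, used backwards, brings the two iterated comultiplications to the same form.
  rw [← c.s_kmap_s_assoc _ _ (by simp), kmap_comp_assoc]
  congr 2
  refine F.kmap_congr (by simp) ?_
  congr 2
  refine F.kmap_congr (by simp) ?_
  rw [Category.comp_id]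
  congr 1
  exact F.kmap_congr e.symm (by simp)

end comp

end ComonadStr

end FunctorialFactorisation

/-! ### Algebra morphisms, and free algebras for the monad. -/

namespace FunctorialFactorisation

variable {F F₁ : FunctorialFactorisation p} {X Y X' Y' X'' Y'' : E}

section IsHom

variable {f : X ⟶ Y} {g : X' ⟶ Y'} {h : X'' ⟶ Y''} {hf : IsVertical p f} {hg : IsVertical p g}
  {hh : IsVertical p h}

/-- The square `(u, v)` is a morphism of algebras. -/
structure Alg.IsHom (a : F.Alg f hf) (b : F.Alg g hg) (u : X ⟶ X') (v : Y ⟶ Y') : Prop where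
  w : u ≫ g = f ≫ v
  str_comp : a.str ≫ u = F.kmap hf hg u v w ≫ b.str

theorem Alg.IsHom.id (a : F.Alg f hf) : a.IsHom a (𝟙 X) (𝟙 Y) where
  w := by simp
  str_comp := by rw [kmap_id, Category.comp_id, Category.id_comp]

theorem Alg.IsHom.comp {a : F.Alg f hf} {b : F.Alg g hg} {d : F.Alg h hh} {u : X ⟶ X'}
    {v : Y ⟶ Y'} {u' : X' ⟶ X''} {v' : Y' ⟶ Y''} (H : a.IsHom b u v) (H' : b.IsHom d u' v') :
    a.IsHom d (u ≫ u') (v ≫ v') where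
  w := by rw [Category.assoc, H'.w, reassoc_of% H.w]
  str_comp := by
    rw [← Category.assoc, H.str_comp, Category.assoc, H'.str_comp, kmap_comp_assoc]

/-- Collapsing one factor of a composite algebra to an identity in this way yields the counit laws
of the induced comonad. -/
theorem Alg.IsHom.to_id (a : F.Alg f hf) (hY : IsVertical p (𝟙 Y)) :
    a.IsHom (Alg.id F Y hY) f (𝟙 Y) where
  w := rfl
  str_comp := by rw [a.fac, Alg.id_str, kmap_r, Category.comp_id]

theorem ComonadStr.isHom_comp (c : F.ComonadStr) {Z Z' : E} {f : X ⟶ Y} {g : Y ⟶ Z} {h : X ⟶ Z}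
    {hf : IsVertical p f} {hg : IsVertical p g} {hh : IsVertical p h} {f' : X' ⟶ Y'}
    {g' : Y' ⟶ Z'} {h' : X' ⟶ Z'} {hf' : IsVertical p f'} {hg' : IsVertical p g'}
    {hh' : IsVertical p h'} {a : F.Alg f hf} {b : F.Alg g hg} {e : f ≫ g = h}
    {a' : F.Alg f' hf'} {b' : F.Alg g' hg'} {e' : f' ≫ g' = h'} {u : X ⟶ X'} {v : Y ⟶ Y'}
    {t : Z ⟶ Z'} (H : a.IsHom a' u v) (H' : b.IsHom b' v t) :
    (c.comp hh a b e).IsHom (c.comp hh' a' b' e') u t where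
  w := by rw [← e, ← e', reassoc_of% H.w, H'.w, Category.assoc]
  str_comp := c.comp_hom a b e a' b' e' H.w H'.w _ H.str_comp H'.str_comp

end IsHom

namespace MonadStr

variable (m : F.MonadStr) {f : X ⟶ Y} {g : X' ⟶ Y'} {hf : IsVertical p f} {hg : IsVertical p g}

/-- The domain component of the multiplication. -/
def π (f : X ⟶ Y) (hf : IsVertical p f) : F.k (F.r f hf) (F.hr f hf) ⟶ F.k f hf :=
  (m.mul.app (Vert.mk f hf)).hom.left

theorem mul_right (f : Vert p) : (m.mul.app f).hom.right = 𝟙 f.obj.right := by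
  obtain ⟨h₁, h₂⟩ := (isVertical_iff _ _).1 (m.mul_vertical f)
  exact h₂.trans (eqToHom_refl _ _)

theorem mul_app (f : X ⟶ Y) (hf : IsVertical p f) (w) :
    m.mul.app (Vert.mk f hf) = Vert.homMk (F.hr _ _) (F.hr f hf) (m.π f hf) (𝟙 Y) w := by
  ext
  · rfl
  · exact m.mul_right _

@[simp]
theorem π_r (f : X ⟶ Y) (hf : IsVertical p f) : m.π f hf ≫ F.r f hf = F.r _ (F.hr f hf) := by
  have := Arrow.w (m.mul.app (Vert.mk f hf)).hom
  rw [m.mul_right] at this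
  exact this.trans (Category.comp_id _)

theorem kmap_π (u : X ⟶ X') (v : Y ⟶ Y') (w : u ≫ g = f ≫ v) :
    F.kmap (F.hr f hf) (F.hr g hg) (F.kmap hf hg u v w) v (F.kmap_r u v w) ≫ m.π g hg =
      m.π f hf ≫ F.kmap hf hg u v w :=
  congrArg (fun t => t.hom.left) (m.mul.naturality (Vert.homMk hf hg u v w))

@[simp]
theorem l_π (f : X ⟶ Y) (hf : IsVertical p f) : F.l _ (F.hr f hf) ≫ m.π f hf = 𝟙 _ :=
  congrArg (fun t => t.hom.left) (m.left_unit (Vert.mk f hf))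

theorem kmap_l_π (f : X ⟶ Y) (hf : IsVertical p f) (w : F.l f hf ≫ F.r f hf = f ≫ 𝟙 Y) :
    F.kmap hf (F.hr f hf) (F.l f hf) (𝟙 Y) w ≫ m.π f hf = 𝟙 _ :=
  congrArg (fun t => t.hom.left) (m.right_unit (Vert.mk f hf))

theorem kmap_π_π (f : X ⟶ Y) (hf : IsVertical p f)
    (w : m.π f hf ≫ F.r f hf = F.r _ (F.hr f hf) ≫ 𝟙 Y) :
    F.kmap (F.hr _ (F.hr f hf)) (F.hr f hf) (m.π f hf) (𝟙 Y) w ≫ m.π f hf =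
      m.π _ (F.hr f hf) ≫ m.π f hf := by
  have := congrArg (fun t => t.hom.left) (m.assoc (Vert.mk f hf))
  rw [m.mul_app f hf w] at this
  exact this

/-- An algebra structure on a vertical map for the monad `R`. -/
structure Alg (f : X ⟶ Y) (hf : IsVertical p f) extends F.Alg f hf where
  assoc : F.kmap (F.hr f hf) hf str (𝟙 Y) (fac.trans (Category.comp_id _).symm) ≫ str =
    m.π f hf ≫ str

/-- The free algebra on a vertical map. -/
def free (f : X ⟶ Y) (hf : IsVertical p f) : m.Alg (F.r f hf) (F.hr f hf) where
  str := m.π f hf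
  unit := m.l_π f hf
  fac := m.π_r f hf
  assoc := m.kmap_π_π f hf _

variable {m}

theorem Alg.isHom_str (a : m.Alg f hf) : (m.free f hf).toAlg.IsHom a.toAlg a.str (𝟙 Y) where
  w := a.fac.trans (Category.comp_id _).symm
  str_comp := a.assoc.symm

theorem isHom_free_kmap (u : X ⟶ X') (v : Y ⟶ Y') (w : u ≫ g = f ≫ v) :
    (m.free f hf).toAlg.IsHom (m.free g hg).toAlg (F.kmap hf hg u v w) v where
  w := F.kmap_r _ _ _
  str_comp := (m.kmap_π u v w).symm

/-- Uniqueness in the universal property of the free algebra: the right unit law writes `t` as a map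
through the multiplication, past which `t` can be moved. -/
theorem Alg.eq_kmap_of_isHom {b : m.Alg g hg} {t : F.k f hf ⟶ X'} {v : Y ⟶ Y'}
    (H : (m.free f hf).toAlg.IsHom b.toAlg t v) :
    t = F.kmap hf hg (F.l f hf ≫ t) v (by rw [Category.assoc, H.w, l_r_assoc]) ≫ b.str := by
  have h₁ : m.π f hf ≫ t = _ := H.str_comp
  calc
    t = (F.kmap hf (F.hr f hf) (F.l f hf) (𝟙 Y) (by simp) ≫ m.π f hf) ≫ t := by
      rw [m.kmap_l_π, Category.id_comp]
    _ = _ := by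
      rw [Category.assoc, h₁, kmap_comp_assoc]
      congr 1
      exact F.kmap_congr rfl (Category.id_comp v)

/-- The monad algebra given by an algebra structure on a vertical map. -/
def Alg.algebra (a : m.Alg f hf) : m.monad.Algebra where
  A := Vert.mk f hf
  a := Vert.homMk (F.hr f hf) hf a.str (𝟙 Y) (a.fac.trans (Category.comp_id _).symm)
  unit := by
    ext
    · exact a.unit
    · exact Category.comp_id _
  assoc := by
    ext
    · exact a.assoc.symm
    · exact congrArg (· ≫ 𝟙 Y) (m.mul_right _)

end MonadStr

/-- An isomorphism, over vertical maps, between the algebras of the monad of `F` and those of the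
pointed endofunctor of `F₁`. -/
structure AlgIso (F₁ : FunctorialFactorisation p) {F : FunctorialFactorisation p}
    (m : F.MonadStr) where
  toAlg : ∀ {X Y : E} {f : X ⟶ Y} {hf : IsVertical p f}, m.Alg f hf → F₁.Alg f hf
  ofAlg : ∀ {X Y : E} {f : X ⟶ Y} {hf : IsVertical p f}, F₁.Alg f hf → m.Alg f hf
  toAlg_ofAlg : ∀ {X Y : E} {f : X ⟶ Y} {hf : IsVertical p f} (a : F₁.Alg f hf),
    toAlg (ofAlg a) = a
  isHom_iff : ∀ {X Y X' Y' : E} {f : X ⟶ Y} {hf : IsVertical p f} {g : X' ⟶ Y'}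
    {hg : IsVertical p g} {a : m.Alg f hf} {b : m.Alg g hg} {u : X ⟶ X'} {v : Y ⟶ Y'},
    (toAlg a).IsHom (toAlg b) u v ↔ a.toAlg.IsHom b.toAlg u v

end FunctorialFactorisation

open FunctorialFactorisation

/-! ### Passing between bundled algebras and their domain components. -/

section

variable {F F₁ : FunctorialFactorisation p} {m : F.MonadStr}

/-- The unit has identity codomain component, so the unit law determines that of `β`; an algebra
amounts to its domain component. -/
theorem right_eq_id_of_unit {f : Vert p} {β : F.R.obj f ⟶ f} (h : F.unit.app f ≫ β = 𝟙 f) :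
    β.hom.right = 𝟙 f.obj.right :=
  (Category.id_comp _).symm.trans (congrArg (fun t => t.hom.right) h)

/-- The domain component of an algebra for the pointed endofunctor `R`. -/
@[simps]
def FunctorialFactorisation.Alg.ofUnit {X Y : E} {f : X ⟶ Y} {hf : IsVertical p f}
    (β : F.R.obj (Vert.mk f hf) ⟶ Vert.mk f hf) (h : F.unit.app (Vert.mk f hf) ≫ β = 𝟙 _) :
    F.Alg f hf where
  str := β.hom.left
  unit := congrArg (fun t => t.hom.left) h
  fac := by
    have := Arrow.w β.hom
    rw [right_eq_id_of_unit h] at this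
    exact this.trans (Category.comp_id _)

theorem FunctorialFactorisation.Alg.ofUnit_isHom_iff {X Y X' Y' : E} {f : X ⟶ Y}
    {hf : IsVertical p f} {g : X' ⟶ Y'} {hg : IsVertical p g}
    {β : F.R.obj (Vert.mk f hf) ⟶ Vert.mk f hf} {h : F.unit.app (Vert.mk f hf) ≫ β = 𝟙 _}
    {γ : F.R.obj (Vert.mk g hg) ⟶ Vert.mk g hg} {h' : F.unit.app (Vert.mk g hg) ≫ γ = 𝟙 _}
    {u : X ⟶ X'} {v : Y ⟶ Y'} (w : u ≫ g = f ≫ v) :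
    (Alg.ofUnit β h).IsHom (Alg.ofUnit γ h') u v ↔
      F.R.map (Vert.homMk hf hg u v w) ≫ γ = β ≫ Vert.homMk hf hg u v w := by
  constructor
  · intro H
    ext
    · exact H.str_comp.symm
    · change v ≫ γ.hom.right = β.hom.right ≫ v
      rw [right_eq_id_of_unit h, right_eq_id_of_unit h']
      exact (Category.comp_id _).trans (Category.id_comp _).symm
  · intro H
    exact ⟨w, (congrArg (fun t => t.hom.left) H).symm⟩

/-- The structure map associated with an algebra of the monad. -/
def StrictAlgIso.strMk (S : StrictAlgIso F₁.R F₁.unit m.monad) {X Y : E} {f : X ⟶ Y}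
    {hf : IsVertical p f} (a : m.Alg f hf) : F₁.R.obj (Vert.mk f hf) ⟶ Vert.mk f hf :=
  S.str a.algebra

theorem StrictAlgIso.unit_strMk (S : StrictAlgIso F₁.R F₁.unit m.monad) {X Y : E} {f : X ⟶ Y}
    {hf : IsVertical p f} (a : m.Alg f hf) :
    F₁.unit.app (Vert.mk f hf) ≫ S.strMk a = 𝟙 (Vert.mk f hf) :=
  S.unit a.algebra

theorem FunctorialFactorisation.MonadStr.Alg.exists_algebra_eq {X Y : E} {f : X ⟶ Y}
    {hf : IsVertical p f} (α : m.monad.obj (Vert.mk f hf) ⟶ Vert.mk f hf)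
    (h₁ : m.monad.η.app (Vert.mk f hf) ≫ α = 𝟙 _)
    (h₂ : m.monad.μ.app (Vert.mk f hf) ≫ α = m.monad.map α ≫ α) :
    ∃ b : m.Alg f hf, b.algebra = ⟨Vert.mk f hf, α, h₁, h₂⟩ := by
  have hα : α = Vert.homMk (F.hr f hf) hf (Alg.ofUnit α h₁).str (𝟙 Y)
      ((Alg.ofUnit α h₁).fac.trans (Category.comp_id _).symm) := by
    ext
    · rfl
    · exact right_eq_id_of_unit h₁
  let b : m.Alg f hf := { Alg.ofUnit α h₁ with
    assoc := by
      have := congrArg (fun t => t.hom.left) h₂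
      rw [hα] at this
      exact this.symm }
  have key : ∀ (α' : F.R.obj (Vert.mk f hf) ⟶ Vert.mk f hf) (h₁' h₂'), α' = α →
      (⟨Vert.mk f hf, α', h₁', h₂'⟩ : m.monad.Algebra) = ⟨Vert.mk f hf, α, h₁, h₂⟩ := by
    rintro _ _ _ rfl
    rfl
  exact ⟨b, key _ b.algebra.unit b.algebra.assoc hα.symm⟩

theorem StrictAlgIso.exists_ofAlg (S : StrictAlgIso F₁.R F₁.unit m.monad) {X Y : E} {f : X ⟶ Y}
    {hf : IsVertical p f} (a : F₁.Alg f hf) :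
    ∃ b : m.Alg f hf, Alg.ofUnit (S.strMk b) (S.unit_strMk b) = a := by
  obtain ⟨α, h₁, h₂, h⟩ := S.surj (Vert.mk f hf)
    (Vert.homMk (F₁.hr f hf) hf a.str (𝟙 Y) (a.fac.trans (Category.comp_id _).symm)) (by
      ext
      · exact a.unit
      · exact Category.comp_id _)
  obtain ⟨b, hb⟩ := MonadStr.Alg.exists_algebra_eq α h₁ h₂
  have hα : b.algebra.a = α := eq_of_heq (Monad.Algebra.mk.inj hb).2
  subst hα
  refine ⟨b, ?_⟩
  ext
  exact congrArg (fun t => t.hom.left) h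

/-- The elementary form of a strict isomorphism of categories of algebras. -/
noncomputable def StrictAlgIso.algIso (S : StrictAlgIso F₁.R F₁.unit m.monad) : AlgIso F₁ m where
  toAlg a := Alg.ofUnit (S.strMk a) (S.unit_strMk a)
  ofAlg a := (S.exists_ofAlg a).choose
  toAlg_ofAlg a := (S.exists_ofAlg a).choose_spec
  isHom_iff {X Y X' Y' f hf g hg a b u v} := by
    constructor
    · intro H
      rw [Alg.ofUnit_isHom_iff H.w] at H
      exact ⟨_, (congrArg (fun t => t.hom.left)
        ((S.hom_iff a.algebra b.algebra (Vert.homMk hf hg u v _)).2 H)).symm⟩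
    · intro H
      rw [Alg.ofUnit_isHom_iff H.w]
      refine (S.hom_iff a.algebra b.algebra (Vert.homMk hf hg u v H.w)).1 ?_
      ext
      · exact H.str_comp.symm
      · exact (Category.comp_id _).trans (Category.id_comp _).symm

end

/-! ### The comultiplication, distributive law and comparison map from freeness. -/

namespace FunctorialFactorisation.AlgIso

variable {F₁ F : FunctorialFactorisation p} {m : F.MonadStr} (S : AlgIso F₁ m)
  {X Y X' Y' : E} {f : X ⟶ Y} {g : X' ⟶ Y'} {hf : IsVertical p f} {hg : IsVertical p g}

/-- The free algebra on a vertical map, as an algebra for the pointed endofunctor. -/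
def free (f : X ⟶ Y) (hf : IsVertical p f) : F₁.Alg (F.r f hf) (F.hr f hf) :=
  S.toAlg (m.free f hf)

/-- The extension of a square into an algebra to a morphism out of the free algebra. -/
def ext (b : F₁.Alg g hg) (u : X ⟶ X') (v : Y ⟶ Y') (w : u ≫ g = f ≫ v) : F.k f hf ⟶ X' :=
  F.kmap hf hg u v w ≫ (S.ofAlg b).str

theorem isHom_str (a : m.Alg f hf) : (S.free f hf).IsHom (S.toAlg a) a.str (𝟙 Y) :=
  S.isHom_iff.2 a.isHom_str

theorem isHom_ofAlg_str (b : F₁.Alg g hg) :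
    (S.free g hg).IsHom b (S.ofAlg b).str (𝟙 Y') := by
  have := S.isHom_str (S.ofAlg b)
  rwa [S.toAlg_ofAlg] at this

theorem isHom_kmap (u : X ⟶ X') (v : Y ⟶ Y') (w : u ≫ g = f ≫ v) :
    (S.free f hf).IsHom (S.free g hg) (F.kmap hf hg u v w) v :=
  S.isHom_iff.2 (MonadStr.isHom_free_kmap u v w)

theorem isHom_π (f : X ⟶ Y) (hf : IsVertical p f) :
    (S.free _ (F.hr f hf)).IsHom (S.free f hf) (m.π f hf) (𝟙 Y) :=
  S.isHom_str (m.free f hf)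

theorem isHom_ext (b : F₁.Alg g hg) (u : X ⟶ X') (v : Y ⟶ Y') (w : u ≫ g = f ≫ v) :
    (S.free f hf).IsHom b (S.ext b u v w) v := by
  have := (S.isHom_kmap (hf := hf) (hg := hg) u v w).comp (S.isHom_ofAlg_str b)
  rwa [Category.comp_id] at this

@[simp]
theorem l_ext (b : F₁.Alg g hg) (u : X ⟶ X') (v : Y ⟶ Y') (w : u ≫ g = f ≫ v) :
    F.l f hf ≫ S.ext b u v w = u := by
  rw [ext, l_kmap_assoc, (S.ofAlg b).unit, Category.comp_id]

theorem hom_ext {b : F₁.Alg g hg} {t t' : F.k f hf ⟶ X'} {v : Y ⟶ Y'}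
    (H : (S.free f hf).IsHom b t v) (H' : (S.free f hf).IsHom b t' v)
    (h : F.l f hf ≫ t = F.l f hf ≫ t') : t = t' := by
  -- Seen as the image of a monad algebra, `b` becomes a legitimate target for the freeness of
  -- `m.free`.
  rw [← S.toAlg_ofAlg b] at H H'
  rw [MonadStr.Alg.eq_kmap_of_isHom (S.isHom_iff.1 H),
    MonadStr.Alg.eq_kmap_of_isHom (S.isHom_iff.1 H')]
  congr 1
  exact F.kmap_congr h rfl

variable (c : F₁.ComonadStr)

theorem vertical_r_r (f : X ⟶ Y) (hf : IsVertical p f) :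
    IsVertical p (F.r (F.l f hf) (F.hl f hf) ≫ F.r f hf) :=
  (F.hr _ _).comp (F.hr _ _)

/-- The composite of the free algebras on the left factor of a map and on the map itself. -/
def freeComp (f : X ⟶ Y) (hf : IsVertical p f) :
    F₁.Alg (F.r (F.l f hf) (F.hl f hf) ≫ F.r f hf) (vertical_r_r f hf) :=
  c.comp (vertical_r_r f hf) (S.free _ (F.hl f hf)) (S.free f hf) rfl

/-- The comultiplication induced by composition of algebras. -/
def s (f : X ⟶ Y) (hf : IsVertical p f) : F.k f hf ⟶ F.k _ (F.hl f hf) :=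
  S.ext (S.freeComp c f hf) (F.l _ (F.hl f hf)) (𝟙 Y) (by simp)

theorem isHom_s (f : X ⟶ Y) (hf : IsVertical p f) :
    (S.free f hf).IsHom (S.freeComp c f hf) (S.s c f hf) (𝟙 Y) :=
  S.isHom_ext _ _ _ _

@[simp]
theorem l_s (f : X ⟶ Y) (hf : IsVertical p f) :
    F.l f hf ≫ S.s c f hf = F.l _ (F.hl f hf) :=
  S.l_ext _ _ _ _

theorem kmap_s (u : X ⟶ X') (v : Y ⟶ Y') (w : u ≫ g = f ≫ v) :
    F.kmap hf hg u v w ≫ S.s c g hg = S.s c f hf ≫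
      F.kmap (F.hl f hf) (F.hl g hg) u (F.kmap hf hg u v w) (F.l_kmap u v w).symm := by
  have h₁ := (S.isHom_kmap (hf := hf) u v w).comp (S.isHom_s c g hg)
  have h₂ := (S.isHom_s c f hf).comp (c.isHom_comp (hh := vertical_r_r f hf)
    (hh' := vertical_r_r g hg) (e := rfl) (e' := rfl)
    (S.isHom_kmap (hf := F.hl f hf) (hg := F.hl g hg) u (F.kmap hf hg u v w)
      (F.l_kmap u v w).symm) (S.isHom_kmap u v w))
  rw [Category.comp_id] at h₁
  rw [Category.id_comp] at h₂
  refine S.hom_ext h₁ h₂ ?_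
  rw [l_kmap_assoc, l_s, ← Category.assoc, l_s, l_kmap]

/-- Collapsing the upper factor of `freeComp` to an identity makes the right factor of `L f` an
algebra morphism back to the free algebra on `f`. For `s_kmap_r` it is the lower factor that
collapses. -/
theorem s_r (f : X ⟶ Y) (hf : IsVertical p f) :
    S.s c f hf ≫ F.r _ (F.hl f hf) = 𝟙 _ := by
  have hK : IsVertical p (𝟙 (F.k f hf)) := isVertical_eqToHom p rfl
  have h₁ := c.isHom_comp (hh := vertical_r_r f hf) (hh' := F.hr f hf) (e := rfl)
    (e' := Category.id_comp _) (Alg.IsHom.to_id (S.free _ (F.hl f hf)) hK)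
    (Alg.IsHom.id (S.free f hf))
  rw [c.id_comp] at h₁
  have h₂ := (S.isHom_s c f hf).comp h₁
  rw [Category.id_comp] at h₂
  refine S.hom_ext h₂ (Alg.IsHom.id _) ?_
  rw [← Category.assoc, l_s, l_r, Category.comp_id]

theorem s_kmap_r (f : X ⟶ Y) (hf : IsVertical p f) (w : 𝟙 X ≫ f = F.l f hf ≫ F.r f hf) :
    S.s c f hf ≫ F.kmap (F.hl f hf) hf (𝟙 X) (F.r f hf) w = 𝟙 _ := by
  have hY : IsVertical p (𝟙 Y) := isVertical_eqToHom p rfl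
  have h₁ := c.isHom_comp (hh := vertical_r_r f hf) (hh' := F.hr f hf) (e := rfl)
    (e' := Category.comp_id _) (S.isHom_kmap (hf := F.hl f hf) (hg := hf) (𝟙 X) (F.r f hf) w)
    (Alg.IsHom.to_id (S.free f hf) hY)
  rw [c.comp_id] at h₁
  have h₂ := (S.isHom_s c f hf).comp h₁
  rw [Category.id_comp] at h₂
  refine S.hom_ext h₂ (Alg.IsHom.id _) ?_
  rw [← Category.assoc, l_s, l_kmap, Category.id_comp, Category.comp_id]

theorem s_kmap_s (f : X ⟶ Y) (hf : IsVertical p f)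
    (w : 𝟙 X ≫ F.l _ (F.hl f hf) = F.l f hf ≫ S.s c f hf) :
    S.s c f hf ≫ F.kmap (F.hl f hf) (F.hl _ (F.hl f hf)) (𝟙 X) (S.s c f hf) w =
      S.s c f hf ≫ S.s c _ (F.hl f hf) := by
  have hv := ((F.hr _ (F.hl _ (F.hl f hf))).comp (vertical_r_r f hf))
  have h₁ := (S.isHom_s c f hf).comp (c.isHom_comp (hh := vertical_r_r f hf)
    (hh' := hv) (e := rfl) (e' := rfl)
    (S.isHom_kmap (hf := F.hl f hf) (hg := F.hl _ (F.hl f hf)) (𝟙 X) (S.s c f hf) w)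
    (S.isHom_s c f hf))
  have h₂ := (S.isHom_s c f hf).comp (c.isHom_comp (hh := vertical_r_r f hf)
    (hh' := hv) (e := rfl) (e' := Category.assoc _ _ _)
    (S.isHom_s c _ (F.hl f hf)) (Alg.IsHom.id (S.free f hf)))
  -- Both morphisms now land in the same triple composite of free algebras.
  rw [freeComp, c.comp_assoc (vgj := vertical_r_r f hf) (e₂ := rfl) (e₃ := rfl)] at h₂
  refine S.hom_ext h₁ h₂ ?_
  rw [← Category.assoc, ← Category.assoc, l_s, l_s, l_kmap, Category.id_comp]

/-- The comonad structure induced by composition of algebras. -/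
def comonadStr : F.ComonadStr where
  comul :=
    { app := fun f => ObjectProperty.homMk (Arrow.homMk (𝟙 f.obj.left) (S.s c f.obj.hom f.property)
        ((Category.id_comp _).trans (S.l_s c f.obj.hom f.property).symm))
      naturality := fun f g φ => by
        ext
        · exact (Category.comp_id _).trans (Category.id_comp _).symm
        · exact S.kmap_s c φ.hom.left φ.hom.right (Arrow.w φ.hom) }
  comul_vertical f := (isVertical_iff _ _).2 ⟨rfl, rfl⟩
  coassoc f := by
    ext
    · rfl
    · exact S.s_kmap_s c f.obj.hom f.property _
  left_counit f := by
    ext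
    · exact Category.id_comp _
    · exact S.s_r c f.obj.hom f.property
  right_counit f := by
    ext
    · exact Category.id_comp _
    · exact S.s_kmap_r c f.obj.hom f.property _

/-- The multiplication is itself an algebra morphism between free algebras, so both sides are fixed
by their restriction to generators. This is the only compatibility of the distributive law not
already a monad or comonad law, or compatibility with the right factor; it serves both `mul` and
`comul`. -/
theorem π_s (f : X ⟶ Y) (hf : IsVertical p f)
    (w : S.s c f hf ≫ F.r _ (F.hl f hf) = F.l _ (F.hr f hf) ≫ m.π f hf) :
    m.π f hf ≫ S.s c f hf = S.s c _ (F.hr f hf) ≫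
      F.kmap (F.hl _ (F.hr f hf)) (F.hr _ (F.hl f hf)) (S.s c f hf) (m.π f hf) w ≫
        m.π _ (F.hl f hf) := by
  have h₁ := (S.isHom_π f hf).comp (S.isHom_s c f hf)
  have h₂ := (S.isHom_kmap (hf := F.hl _ (F.hr f hf)) (hg := F.hr _ (F.hl f hf)) (S.s c f hf)
    (m.π f hf) w).comp (S.isHom_π _ (F.hl f hf))
  rw [Category.comp_id] at h₂
  have h₃ := (S.isHom_s c _ (F.hr f hf)).comp (c.isHom_comp (hh := vertical_r_r _ (F.hr f hf))
    (hh' := vertical_r_r f hf) (e := rfl) (e' := rfl) h₂ (S.isHom_π f hf))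
  refine S.hom_ext h₁ h₃ ?_
  rw [← Category.assoc, ← Category.assoc, l_s, m.l_π, l_kmap_assoc, m.l_π, Category.id_comp,
    Category.comp_id]

theorem isDistributiveLaw :
    IsDistributiveLaw (S.comonadStr c).comonad m.monad (canonicalMap (S.comonadStr c) m) where
  unit f := by
    ext
    · exact S.l_s c f.obj.hom f.property
    · exact m.kmap_l_π f.obj.hom f.property _
  counit f := by
    ext
    · exact S.s_kmap_r c f.obj.hom f.property _
    · exact m.π_r f.obj.hom f.property
  mul f := by
    ext
    · exact S.π_s c f.obj.hom f.property _
    · change F.K.map (m.mul.app f) ≫ (m.mul.app f).hom.left =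
        (m.mul.app (F.R.obj f)).hom.left ≫ (m.mul.app f).hom.left ≫
          (m.mul.app (F.L.obj f)).hom.right
      rw [m.mul_right]
      exact (congrArg (fun t => t.hom.left) (m.assoc f)).trans
        (congrArg (_ ≫ ·) (Category.comp_id _).symm)
  comul f := by
    ext
    · exact (congrArg (fun t => t.hom.right) ((S.comonadStr c).coassoc f)).trans
        (Category.id_comp _).symm
    · exact S.π_s c f.obj.hom f.property _

/-- The awfs whose monad is `m`. -/
def awfs : Awfs p := ⟨F, S.comonadStr c, m, S.isDistributiveLaw c⟩

/-- The components of the morphism from the pointed endofunctor to the monad. -/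
def ξ (f : X ⟶ Y) (hf : IsVertical p f) : F₁.k f hf ⟶ F.k f hf :=
  F₁.kmap hf (F.hr f hf) (F.l f hf) (𝟙 Y) (by simp) ≫ (S.free f hf).str

theorem l_ξ (f : X ⟶ Y) (hf : IsVertical p f) : F₁.l f hf ≫ S.ξ f hf = F.l f hf := by
  rw [ξ, l_kmap_assoc, Alg.unit, Category.comp_id]

theorem ξ_r (f : X ⟶ Y) (hf : IsVertical p f) : S.ξ f hf ≫ F.r f hf = F₁.r f hf := by
  rw [ξ, Category.assoc, Alg.fac, kmap_r, Category.comp_id]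

/-- An algebra morphism out of a free algebra commutes with the `F₁`-structure maps, so after `ξ` it
is computed by the structure of its target. -/
theorem ξ_comp {b : F₁.Alg g hg} {t : F.k f hf ⟶ X'} {v : Y ⟶ Y'}
    (H : (S.free f hf).IsHom b t v) :
    S.ξ f hf ≫ t = F₁.kmap hf hg (F.l f hf ≫ t) v (by rw [Category.assoc, H.w, l_r_assoc]) ≫
      b.str := by
  rw [ξ, Category.assoc, H.str_comp, kmap_comp_assoc]
  congr 1
  exact F₁.kmap_congr rfl (Category.id_comp v)

theorem ξ_str (a : m.Alg f hf) : S.ξ f hf ≫ a.str = (S.toAlg a).str := by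
  rw [S.ξ_comp (S.isHom_str a), F₁.kmap_congr a.unit rfl, kmap_id, Category.id_comp]

theorem kmap_ξ (u : X ⟶ X') (v : Y ⟶ Y') (w : u ≫ g = f ≫ v) :
    F₁.kmap hf hg u v w ≫ S.ξ g hg = S.ξ f hf ≫ F.kmap hf hg u v w := by
  rw [S.ξ_comp (S.isHom_kmap u v w), ξ, kmap_comp_assoc]
  congr 1
  exact F₁.kmap_congr (F.l_kmap u v w).symm (Category.comp_id v)

/-- By `ξ_comp` the left side is computed by the structure map of `freeComp`, whose formula contains
the comultiplication of `F₁`. -/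
theorem ξ_s (f : X ⟶ Y) (hf : IsVertical p f) :
    S.ξ f hf ≫ S.s c f hf = c.s f hf ≫ S.ξ _ (F₁.hl f hf) ≫
      F.kmap (F₁.hl f hf) (F.hl f hf) (𝟙 X) (S.ξ f hf)
        ((Category.id_comp _).trans (S.l_ξ f hf).symm) := by
  have hξ : S.ξ _ (F.hl f hf) = _ ≫ (S.free _ (F.hl f hf)).str := rfl
  have hs : (S.freeComp c f hf).str = _ := c.comp_str _ _ _ _
  rw [S.ξ_comp (S.isHom_s c f hf), hs, c.kmap_s_assoc,
    kmap_comp_assoc, ← S.kmap_ξ, hξ, F₁.kmap_comp_assoc (𝟙 X)]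
  congr 2
  refine F₁.kmap_congr (by simp) ?_
  rw [kmap_comp_assoc, Category.comp_id (S.ξ f hf)]
  congr 1
  exact F₁.kmap_congr (by simp) (by simp)

end FunctorialFactorisation.AlgIso

/-! ### Algebraic freeness of the constructed awfs. -/

open FunctorialFactorisation

/-- The morphism from a lawfs to the awfs whose algebras are those of the lawfs. -/
def FunctorialFactorisation.AlgIso.lawfsHom {A : Lawfs p} {F : FunctorialFactorisation p}
    {m : F.MonadStr} (S : AlgIso A.ff m) : Lawfs.Hom A (S.awfs A.comonadStr).toLawfs where
  app :=
    { app := fun f => S.ξ f.obj.hom f.property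
      naturality := fun f g φ => S.kmap_ξ φ.hom.left φ.hom.right (Arrow.w φ.hom) }
  left_app := by
    ext f
    exact S.l_ξ f.obj.hom f.property
  app_right := by
    ext f
    exact S.ξ_r f.obj.hom f.property
  comul_comp f := by
    ext
    · exact (congrArg (𝟙 f.obj.left ≫ ·) (Category.id_comp (𝟙 f.obj.left))).symm.trans
        (congrArg (· ≫ 𝟙 f.obj.left ≫ 𝟙 f.obj.left) (A.comonadStr.comul_left f).symm)
    · exact S.ξ_s A.comonadStr f.obj.hom f.property

theorem StrictAlgIso.isAlgebraicallyFree {A : Lawfs p} {F : FunctorialFactorisation p}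
    {m : F.MonadStr} (S : StrictAlgIso A.ff.R A.ff.unit m.monad) :
    IsAlgebraicallyFree A (S.algIso.awfs A.comonadStr) S.algIso.lawfsHom := by
  refine S.isIso_of_str _ (fun y => ?_) rfl
  obtain ⟨f, α, h₁, h₂⟩ := y
  obtain ⟨b, hb⟩ := MonadStr.Alg.exists_algebra_eq (f := f.obj.hom) (hf := f.property) α h₁ h₂
  have hα : b.algebra.a = α := eq_of_heq (Monad.Algebra.mk.inj hb).2
  subst hα
  -- Restriction along `ξ` agrees on objects with the given isomorphism, which suffices for
  -- `isIso_of_str`.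
  have key : S.algIso.lawfsHom.toHom.onR.app f ≫ b.algebra.a = S.strMk b := by
    ext
    · exact S.algIso.ξ_str b
    · have hr : (S.strMk b).hom.right = 𝟙 f.obj.right := right_eq_id_of_unit (S.unit_strMk b)
      exact Eq.trans (Category.comp_id (𝟙 f.obj.right)) hr.symm
  have aux : ∀ (β β' : A.ff.R.obj f ⟶ f) (hβ hβ'), β = β' →
      (⟨⟨f, β⟩, hβ⟩ : A.RAlg) = ⟨⟨f, β'⟩, hβ'⟩ := by
    rintro β _ _ _ rfl
    rfl
  exact aux _ _ _ _ key

end FibAwfs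

theorem mainTheorem4 {E : Type u} [Category.{v} E] {B : Type u'} [Category.{v'} B]
    (p : E ⥤ B) [p.IsFibered] (A : FibAwfs.Lawfs p) :
    (∃ (W : FibAwfs.Awfs p) (ξ : FibAwfs.Lawfs.Hom A W.toLawfs),
        FibAwfs.IsAlgebraicallyFree A W ξ) ↔
      FibAwfs.IsMonadicOver A.forget (FibAwfs.Vert.cod p) := by
  constructor
  · rintro ⟨W, ξ, h⟩
    exact h.isMonadicOver
  · intro h
    obtain ⟨F, m, ⟨S⟩⟩ := h.exists_strictAlgIso
    exact ⟨_, _, S.isAlgebraicallyFree⟩
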